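/- All graphs are finite and simple. For a connected graph $G$, the longest path transversal number $\mathsf{lpt}(G)$ is the minimum size of a set of vertices of $G$ that meets every longest path of $G$, i.e. every path with the maximum number of edges among all paths of $G$. The treewidth $\mathsf{tw}(H)$ is the minimum, over all tree decompositions of $H$, of the maximum bag size minus one. A subdivision of $H$ is a graph obtained from $H$ by replacing each edge $xy$ by a path of length at least one from $x$ to $y$, such that the interiors of these paths are pairwise disjoint and anticomplete (and consist of new vertices). A graph $G$ is an $H$-graph if there are a subdivision $H'$ of $H$ and a map $\Phi\colon V(G)\to 2^{V(H')}$ such that $H'[\Phi(v)]$ is non-empty and connected for every $v\in V(G)$, and distinct $u,v\in V(G)$ are adjacent in $G$ if and only if $\Phi(u)\cap\Phi(v)\neq\emptyset$. **Theorem.** For every connected graph $H$ with at least two vertices, every connected $H$-graph $G$ satisfies $$\mathsf{lpt}(G)\leq 4\,(\mathsf{tw}(H)+1)\,|E(H)|.$$ -/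

import Mathlib

namespace HGraphs

/-! ### Longest path transversals -/

/-- A path of `G` attaining the maximum length (number of edges) among all paths of `G`. -/
def IsLongestPath {V : Type*} {G : SimpleGraph V} {u v : V} (p : G.Walk u v) : Prop :=
  p.IsPath ∧ ∀ (u' v' : V) (q : G.Walk u' v'), q.IsPath → q.length ≤ p.length

/-- A set of vertices that meets every longest path of `G`. -/
def IsLongestPathTransversal {V : Type*} (G : SimpleGraph V) (S : Finset V) : Prop :=
  ∀ (u v : V) (p : G.Walk u v), IsLongestPath p → ∃ x ∈ S, x ∈ p.support

/-- The longest path transversal number: the minimum size of a longest path transversal.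
For a finite graph the minimum is over a nonempty set (all vertices form a transversal). -/
noncomputable def lpt {V : Type*} (G : SimpleGraph V) : ℕ :=
  sInf {k : ℕ | ∃ S : Finset V, IsLongestPathTransversal G S ∧ S.card = k}

/-! ### Treewidth -/

/-- A tree decomposition of `G` whose tree has vertex set `ι`. -/
structure TreeDecomposition {V : Type*} (G : SimpleGraph V) (ι : Type*) where
  /-- the tree -/
  tree : SimpleGraph ι
  isTree : tree.IsTree
  /-- the bags -/
  bag : ι → Finset V
  mem_bag : ∀ v : V, ∃ t : ι, v ∈ bag t
  adj_bag : ∀ u v : V, G.Adj u v → ∃ t : ι, u ∈ bag t ∧ v ∈ bag t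
  connected_bag : ∀ v : V, (tree.induce {t : ι | v ∈ bag t}).Connected

/-- The width: maximum bag size minus one. (If `G` has a vertex, the maximum is at least one,
so the subtraction is the true one.) -/
def TreeDecomposition.width {V : Type*} {G : SimpleGraph V} {ι : Type*} [Fintype ι]
    (D : TreeDecomposition G ι) : ℕ :=
  (Finset.univ.sup fun t : ι => (D.bag t).card) - 1

/-- The treewidth: the minimum width of a tree decomposition (over a finite tree). For a finite
graph there always is one, namely the single bag of all vertices. -/
noncomputable def treewidth {V : Type*} (G : SimpleGraph V) : ℕ :=
  sInf {k : ℕ | ∃ (ι : Type) (_ : Fintype ι) (D : TreeDecomposition G ι), D.width = k}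

/-! ### Subdivisions and `H`-graphs -/

/-- The data exhibiting `K` as a subdivision of `H`: the vertices of `H` embed into those of `K`,
each edge `uv` of `H` is replaced by a path of `K` between the images of `u` and `v`, the
interiors of these paths contain no image of a vertex of `H` and are pairwise disjoint, and `K` has
no vertices or edges other than those of the paths and the images of vertices of `H`.
(The paths have length at least one since `u ≠ v`; their interiors are pairwise anticomplete since
each edge of `K` lies on one of the paths.) -/
structure Subdivision {U W : Type*} (H : SimpleGraph U) (K : SimpleGraph W) where
  /-- the embedding of the vertices of `H` -/
  branch : U ↪ W
  /-- the path that replaces an edge -/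
  path : ∀ {u v : U}, H.Adj u v → K.Walk (branch u) (branch v)
  isPath : ∀ {u v : U} (h : H.Adj u v), (path h).IsPath
  path_symm : ∀ {u v : U} (h : H.Adj u v), path h.symm = (path h).reverse
  branch_mem_path : ∀ {u v : U} (h : H.Adj u v) (w : U),
    branch w ∈ (path h).support → w = u ∨ w = v
  interior_disjoint : ∀ {u v u' v' : U} (h : H.Adj u v) (h' : H.Adj u' v') (x : W),
    s(u, v) ≠ s(u', v') → x ∈ (path h).support → x ∈ (path h').support → x ∈ Set.range branch
  vertex_cover : ∀ x : W, x ∈ Set.range branch ∨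
    ∃ (u v : U) (h : H.Adj u v), x ∈ (path h).support
  edge_cover : ∀ e ∈ K.edgeSet, ∃ (u v : U) (h : H.Adj u v), e ∈ (path h).edges

/-- An `H`-representation of `G` over the subdivision `K` of `H`: each vertex `v` of `G` is
assigned a set of vertices of `K` inducing a connected (nonempty) subgraph, and distinct
vertices are adjacent in `G` if and only if their sets intersect. -/
structure Representation {U V W : Type*} (H : SimpleGraph U) (G : SimpleGraph V)
    (K : SimpleGraph W) where
  subdivision : Subdivision H K
  /-- the segments -/
  segment : V → Set W
  connected_segment : ∀ v : V, (K.induce (segment v)).Connected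
  adj_iff : ∀ u v : V, u ≠ v → (G.Adj u v ↔ (segment u ∩ segment v).Nonempty)

/-- `G` is an `H`-graph: it has an `H`-representation over some (finite) subdivision of `H`. -/
def IsHGraph {U V : Type*} (H : SimpleGraph U) (G : SimpleGraph V) : Prop :=
  ∃ (W : Type) (_ : Fintype W) (K : SimpleGraph W), Nonempty (Representation H G K)

end HGraphs

/-! For a longest path `p`, let `M` be the union of the segments of its vertices. It is connected in
the subdivision `K`, and any two such sets meet, because two longest paths of a connected graph
share a vertex (`IsLongestPath.exists_common`).

Such a family is hit by `treewidth H + 1` points of `K` (`Subdivision.exists_hitting`). If every set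
contains a branch vertex, the traces on `H` are connected and pairwise equal-or-adjacent somewhere,
hence a bramble, and by the Helly property of subtrees some bag meets them all. Otherwise some set
lies inside a single subdivided edge, and two points suffice.

Each hitting point `x` is then traded for at most `4 * |E(H)|` vertices of `G` whose segments
contain `x` and cover every segment through `x` (`Subdivision.exists_cover`). These dominate the
neighbourhood of any `v` whose segment contains `x`, so a longest path through `v` that avoided them
could be lengthened by inserting one right after `v` (`IsLongestPath.exists_mem_support`). -/

namespace HGraphs

/-! ### Walks inside a set -/

/-- There is a walk of `G` from `x` to `y` all of whose vertices lie in `S`. -/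
def Linked {V : Type*} (G : SimpleGraph V) (S : Set V) (x y : V) : Prop :=
  ∃ p : G.Walk x y, ∀ z ∈ p.support, z ∈ S

namespace Linked

variable {V : Type*} {G : SimpleGraph V} {S T : Set V} {x y z : V}

theorem refl (h : x ∈ S) : Linked G S x x :=
  ⟨.nil, by simpa using h⟩

theorem trans (h : Linked G S x y) (h' : Linked G S y z) : Linked G S x z := by
  obtain ⟨p, hp⟩ := h
  obtain ⟨q, hq⟩ := h'
  refine ⟨p.append q, fun w hw => ?_⟩
  rcases SimpleGraph.Walk.mem_support_append_iff _ _ |>.1 hw with h | h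
  exacts [hp w h, hq w h]

theorem symm (h : Linked G S x y) : Linked G S y x := by
  obtain ⟨p, hp⟩ := h
  exact ⟨p.reverse, fun w hw => hp w (by simpa using hw)⟩

theorem mono (hST : S ⊆ T) (h : Linked G S x y) : Linked G T x y := by
  obtain ⟨p, hp⟩ := h
  exact ⟨p, fun w hw => hST (hp w hw)⟩

theorem of_adj (h : G.Adj x y) (hx : x ∈ S) (hy : y ∈ S) : Linked G S x y :=
  ⟨h.toWalk, by simp [hx, hy]⟩

theorem exists_isPath (h : Linked G S x y) : ∃ p : G.Walk x y, p.IsPath ∧ ∀ z ∈ p.support, z ∈ S := by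
  classical
  obtain ⟨p, hp⟩ := h
  exact ⟨p.bypass, p.bypass_isPath, fun z hz => hp z (p.support_bypass_subset_support hz)⟩

/-- A property that holds at the start of a walk inside `S` and is passed on to neighbours in `S`
holds at the end of the walk. -/
theorem induct (h : Linked G S x y) (P : V → Prop) (hx : P x)
    (step : ∀ a b, G.Adj a b → a ∈ S → b ∈ S → P a → P b) : P y := by
  obtain ⟨p, hp⟩ := h
  induction p with
  | nil => exact hx
  | cons hadj q ih =>
    have hmem : ∀ z ∈ q.support, z ∈ S := fun z hz => hp z (by simp [hz])
    exact ih (step _ _ hadj (hp _ (by simp)) (hmem _ (by simp)) hx) hmem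

theorem of_connected (h : (G.induce S).Connected) (hx : x ∈ S) (hy : y ∈ S) : Linked G S x y := by
  have key : ∀ a b : S, (G.induce S).Walk a b → Linked G S a b := fun a b p => by
    induction p with
    | nil => exact refl (Subtype.prop _)
    | @cons a b _ hadj _ ih =>
      have hab : G.Adj a b := hadj
      exact (of_adj hab a.2 b.2).trans ih
  exact (h.preconnected ⟨x, hx⟩ ⟨y, hy⟩).elim fun p => key _ _ p

end Linked

/-- Any two vertices of `S` are joined by a walk inside `S`. -/
def IsLinked {V : Type*} (G : SimpleGraph V) (S : Set V) : Prop :=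
  ∀ x ∈ S, ∀ y ∈ S, Linked G S x y

/-! ### Longest paths -/

section Paths

variable {V : Type*} {G : SimpleGraph V}

theorem isPath_append {u v w : V} {p : G.Walk u v} {q : G.Walk v w} (hp : p.IsPath) (hq : q.IsPath)
    (h : ∀ x ∈ p.support, x ∈ q.support → x = v) : (p.append q).IsPath := by
  rw [SimpleGraph.Walk.isPath_def] at *
  rw [SimpleGraph.Walk.support_append]
  rw [← SimpleGraph.Walk.cons_tail_support q, List.nodup_cons] at hq
  refine List.nodup_append.2 ⟨hp, hq.2, fun a ha b hb hab => ?_⟩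
  subst hab
  have := h a ha (List.mem_of_mem_tail hb)
  subst this
  exact hq.1 hb

theorem exists_half_path {u v a : V} {p : G.Walk u v} (hp : p.IsPath) (ha : a ∈ p.support) :
    ∃ (c : V) (q : G.Walk c a), q.IsPath ∧ (∀ x ∈ q.support, x ∈ p.support) ∧
      p.length ≤ 2 * q.length := by
  classical
  have hlen := congrArg SimpleGraph.Walk.length (p.take_spec ha)
  rw [SimpleGraph.Walk.length_append] at hlen
  rcases le_total (p.takeUntil a ha).length (p.dropUntil a ha).length with h | h
  · refine ⟨v, (p.dropUntil a ha).reverse, (hp.dropUntil ha).reverse, fun x hx => ?_, ?_⟩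
    · exact p.support_dropUntil_subset_support ha (by simpa using hx)
    · rw [SimpleGraph.Walk.length_reverse]; omega
  · exact ⟨u, p.takeUntil a ha, hp.takeUntil ha,
      fun x hx => p.support_takeUntil_subset_support ha hx, by omega⟩

/-- Any two longest paths of a connected graph have a common vertex. -/
theorem IsLongestPath.exists_common (hG : G.Connected) {u v u' v' : V} {p : G.Walk u v}
    {q : G.Walk u' v'} (hp : IsLongestPath p) (hq : IsLongestPath q) :
    ∃ x ∈ p.support, x ∈ q.support := by
  classical
  by_contra! hdis
  -- A shortest connection `r` between the two paths meets each of them only in its own end.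
  let P : ℕ → Prop := fun n => ∃ a ∈ p.support, ∃ b ∈ q.support, ∃ r : G.Walk a b, r.length = n
  have hex : ∃ n, P n := by
    obtain ⟨r⟩ := hG.preconnected u u'
    exact ⟨_, u, by simp, u', by simp, r, rfl⟩
  obtain ⟨a, ha, b, hb, r, hr⟩ := Nat.find_spec hex
  have hmin : ∀ c ∈ p.support, ∀ d ∈ q.support, ∀ s : G.Walk c d, r.length ≤ s.length :=
    fun c hc d hd s => hr ▸ Nat.find_min' hex ⟨c, hc, d, hd, s, rfl⟩
  have hrpath : r.IsPath := by
    have h1 := hmin a ha b hb r.bypass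
    rw [← SimpleGraph.Walk.bypass_eq_self_of_length_le_length_bypass r h1]
    exact r.bypass_isPath
  have hrp : ∀ c ∈ p.support, c ∈ r.support → c = a := fun c hc hcr => by
    have h1 := hmin c hc b hb (r.dropUntil c hcr)
    have hlen := congrArg SimpleGraph.Walk.length (r.take_spec hcr)
    rw [SimpleGraph.Walk.length_append] at hlen
    exact (SimpleGraph.Walk.eq_of_length_eq_zero (p := r.takeUntil c hcr) (by omega)).symm
  have hrq : ∀ c ∈ q.support, c ∈ r.support → c = b := fun c hc hcr => by
    have h1 := hmin a ha c hc (r.takeUntil c hcr)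
    have hlen := congrArg SimpleGraph.Walk.length (r.take_spec hcr)
    rw [SimpleGraph.Walk.length_append] at hlen
    exact SimpleGraph.Walk.eq_of_length_eq_zero (p := r.dropUntil c hcr) (by omega)
  obtain ⟨c, A, hA, hAp, hAl⟩ := exists_half_path hp.1 ha
  obtain ⟨d, B, hB, hBq, hBl⟩ := exists_half_path hq.1 hb
  have hRB : (r.append B.reverse).IsPath :=
    isPath_append hrpath hB.reverse fun x hx hx' => hrq x (hBq x (by simpa using hx')) hx
  have hARB : (A.append (r.append B.reverse)).IsPath := by
    refine isPath_append hA hRB fun x hx hx' => ?_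
    rcases (SimpleGraph.Walk.mem_support_append_iff _ _).1 hx' with h | h
    · exact hrp x (hAp x hx) h
    · exact absurd (hBq x (by simpa using h)) (hdis x (hAp x hx))
  -- `p` and `q` have equal length, so half of each joined by the nontrivial `r` is too long.
  have h0 : r.length ≠ 0 := fun h =>
    hdis a ha (SimpleGraph.Walk.eq_of_length_eq_zero h ▸ hb)
  have h1 := hp.2 _ _ _ hARB
  have h2 := hp.2 _ _ _ hq.1
  have h3 := hq.2 _ _ _ hp.1
  simp only [SimpleGraph.Walk.length_append, SimpleGraph.Walk.length_reverse] at h1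
  omega

/-- If the neighbours `S` of a vertex `v` of a longest path is such that each neighbour of `v` has a
neighbour in `S` (or lies in `S`), then `S` meets that path. -/
theorem IsLongestPath.exists_mem_support {a b v : V} {p : G.Walk a b} (hp : IsLongestPath p)
    (hv : v ∈ p.support) {S : Finset V} (hne : S.Nonempty) (hS : ∀ s ∈ S, v ≠ s → G.Adj v s)
    (h : ∀ w, G.Adj v w → ∃ s ∈ S, s ≠ w → G.Adj s w) : ∃ s ∈ S, s ∈ p.support := by
  classical
  by_contra! hsp
  replace hS : ∀ s ∈ S, G.Adj v s := fun s hs => hS s hs fun h => hsp s hs (h ▸ hv)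
  obtain ⟨p₁, p₂, rfl⟩ : ∃ (p₁ : G.Walk a v) (p₂ : G.Walk v b), p = p₁.append p₂ :=
    ⟨_, _, (p.take_spec hv).symm⟩
  have hpath := hp.1
  rw [SimpleGraph.Walk.isPath_def] at hpath
  -- If `v` ends the path, any `s` can be appended; otherwise `s` fits between `v` and its successor
  -- `w`.
  cases p₂ with
  | nil =>
    obtain ⟨s, hs⟩ := hne
    have hsp := hsp s hs
    have hs := hS s hs
    have : (p₁.append hs.toWalk).IsPath := by
      rw [SimpleGraph.Walk.isPath_def]
      simp [SimpleGraph.Walk.support_append] at hpath hsp ⊢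
      exact List.nodup_append.2 ⟨hpath, by simp, by grind⟩
    have := hp.2 _ _ _ this
    simp at this
  | @cons _ w _ hvw p₃ =>
    obtain ⟨s, hs, hsw⟩ := h w hvw
    have hsp := hsp s hs
    have hs := hS s hs
    have hws : s ≠ w := by rintro rfl; exact hsp (by simp)
    have : (p₁.append (.cons hs (.cons (hsw hws) p₃))).IsPath := by
      rw [SimpleGraph.Walk.isPath_def]
      simp [SimpleGraph.Walk.support_append] at hpath hsp ⊢
      rw [List.nodup_append] at hpath ⊢
      refine ⟨hpath.1, by simp [hsp, hpath.2.1], ?_⟩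
      grind
    have := hp.2 _ _ _ this
    simp at this

end Paths

/-! ### Subtrees of a tree -/

/-- The Helly property of subtrees. -/
theorem exists_mem_of_pairwise_inter {ι κ : Type*} {T : SimpleGraph ι} (hT : T.IsTree) [Finite κ]
    [Nonempty κ] (S : κ → Set ι) (hne : ∀ i, (S i).Nonempty) (hS : ∀ i, IsLinked T (S i))
    (hinter : ∀ i j, (S i ∩ S j).Nonempty) : ∃ t, ∀ i, t ∈ S i := by
  classical
  obtain ⟨r⟩ := hT.connected.nonempty
  choose P hP hPu using hT.existsUnique_path r
  -- With the tree rooted at `r`, the vertex of `S i` nearest the root is its gate: the root path to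
  -- any `x ∈ S i` passes through it and stays in `S i` from there on.
  have gate : ∀ i, ∃ g ∈ S i, ∀ x ∈ S i, ∃ q : T.Walk g x,
      (P g).append q = P x ∧ ∀ z ∈ q.support, z ∈ S i := by
    intro i
    let Q : ℕ → Prop := fun n => ∃ g ∈ S i, (P g).length = n
    have hex : ∃ n, Q n := by
      obtain ⟨x, hx⟩ := hne i
      exact ⟨_, x, hx, rfl⟩
    obtain ⟨g, hg, hgl⟩ := Nat.find_spec hex
    refine ⟨g, hg, fun x hx => ?_⟩
    obtain ⟨q, hq, hqS⟩ := (hS i g hg x hx).exists_isPath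
    refine ⟨q, hPu x _ (isPath_append (hP g) hq fun z hz hzq => ?_), hqS⟩
    have h1 : (P g).length ≤ (P z).length := hgl ▸ Nat.find_min' hex ⟨z, hqS z hzq, rfl⟩
    have h2 : (P g).takeUntil z hz = P z := hPu z _ ((hP g).takeUntil hz)
    have hlen := congrArg SimpleGraph.Walk.length ((P g).take_spec hz)
    rw [SimpleGraph.Walk.length_append, h2] at hlen
    exact SimpleGraph.Walk.eq_of_length_eq_zero (p := (P g).dropUntil z hz) (by omega)
  choose g hg hgate using gate
  -- The deepest gate lies in every `S j`: on the root path to a common point `x` it comes no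
  -- earlier than the gate of `S j`.
  obtain ⟨i, hi⟩ := Finite.exists_max fun i => (P (g i)).length
  refine ⟨g i, fun j => ?_⟩
  obtain ⟨x, hxi, hxj⟩ := hinter i j
  obtain ⟨q, hq, -⟩ := hgate i x hxi
  obtain ⟨q', hq', hq'S⟩ := hgate j x hxj
  have h1 : (P x).getVert (P (g i)).length = g i := by
    rw [← hq, SimpleGraph.Walk.getVert_append]; simp
  rw [← hq', SimpleGraph.Walk.getVert_append, if_neg (not_lt.2 (hi j))] at h1
  rw [← h1]
  exact hq'S _ (SimpleGraph.Walk.getVert_mem_support _ _)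

/-! ### The paths of a subdivision -/

namespace Subdivision

variable {U W : Type*} {H : SimpleGraph U} {K : SimpleGraph W} (D : Subdivision H K)

/-- The `i`-th vertex of the path that replaces an oriented edge. -/
def pt (d : H.Dart) (i : ℕ) : W := (D.path d.adj).getVert i

/-- The length of the path that replaces an oriented edge. -/
def len (d : H.Dart) : ℕ := (D.path d.adj).length

theorem pt_zero (d : H.Dart) : D.pt d 0 = D.branch d.fst := by simp [pt]

theorem pt_len (d : H.Dart) : D.pt d (D.len d) = D.branch d.snd := by simp [pt, len]

theorem len_symm (d : H.Dart) : D.len d.symm = D.len d := by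
  have h := congrArg SimpleGraph.Walk.length (D.path_symm d.adj)
  rwa [SimpleGraph.Walk.length_reverse] at h

theorem pt_symm (d : H.Dart) (i : ℕ) : D.pt d.symm i = D.pt d (D.len d - i) := by
  have h := congrArg (fun p => SimpleGraph.Walk.getVert p i) (D.path_symm d.adj)
  exact h.trans (SimpleGraph.Walk.getVert_reverse _ _)

theorem pt_inj {d : H.Dart} {i j : ℕ} (hi : i ≤ D.len d) (hj : j ≤ D.len d)
    (h : D.pt d i = D.pt d j) : i = j :=
  (D.isPath d.adj).getVert_injOn hi hj h

theorem pt_mem_support (d : H.Dart) (i : ℕ) : D.pt d i ∈ (D.path d.adj).support :=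
  SimpleGraph.Walk.getVert_mem_support _ _

theorem eq_of_pt_eq_branch {d : H.Dart} {i : ℕ} {w : U} (hi : i ≤ D.len d)
    (h : D.pt d i = D.branch w) : i = 0 ∧ w = d.fst ∨ i = D.len d ∧ w = d.snd := by
  rcases D.branch_mem_path d.adj w (h ▸ D.pt_mem_support d i) with rfl | rfl
  · rw [← D.pt_zero] at h
    exact .inl ⟨D.pt_inj hi (Nat.zero_le _) h, rfl⟩
  · rw [← D.pt_len] at h
    exact .inr ⟨D.pt_inj hi le_rfl h, rfl⟩

theorem exists_pt_of_mem_support {u v : U} (h : H.Adj u v) {y : W} (hy : y ∈ (D.path h).support) :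
    ∃ i ≤ D.len ⟨(u, v), h⟩, D.pt ⟨(u, v), h⟩ i = y := by
  obtain ⟨i, hi, hl⟩ := SimpleGraph.Walk.mem_support_iff_exists_getVert.1 hy
  exact ⟨i, hl, hi⟩

theorem exists_pt (hH : ∀ u, ∃ v, H.Adj u v) (y : W) : ∃ d, ∃ i ≤ D.len d, D.pt d i = y := by
  rcases D.vertex_cover y with ⟨u, rfl⟩ | ⟨u, v, h, hy⟩
  · obtain ⟨v, h⟩ := hH u
    exact ⟨⟨(u, v), h⟩, 0, Nat.zero_le _, D.pt_zero _⟩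
  · exact ⟨_, D.exists_pt_of_mem_support h hy⟩

theorem exists_pt_of_adj {y z : W} (h : K.Adj y z) :
    ∃ d, ∃ i < D.len d, D.pt d i = y ∧ D.pt d (i + 1) = z := by
  obtain ⟨u, v, huv, he⟩ := D.edge_cover s(y, z) h
  obtain ⟨i, hi, h⟩ := (SimpleGraph.Walk.mk_mem_edges_iff_exists _).1 he
  let d : H.Dart := ⟨(u, v), huv⟩
  rcases Sym2.eq_iff.1 h with ⟨h1, h2⟩ | ⟨h1, h2⟩
  · exact ⟨d, i, hi, h1, h2⟩
  · have hi' : i < D.len d := hi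
    refine ⟨d.symm, D.len d - (i + 1), by rw [len_symm]; omega, ?_, ?_⟩
    · rw [pt_symm, show D.len d - (D.len d - (i + 1)) = i + 1 by omega]; exact h2
    · rw [pt_symm, show D.len d - (D.len d - (i + 1) + 1) = i by omega]; exact h1

/-- Interiors of different subdivided edges are disjoint, so an interior point determines its edge,
and its position up to reversal. -/
theorem eq_or_symm_of_pt_eq {d d' : H.Dart} {i j : ℕ} (hi0 : 0 < i) (hi : i < D.len d)
    (hj : j ≤ D.len d') (h : D.pt d i = D.pt d' j) :
    d' = d ∧ j = i ∨ d' = d.symm ∧ j = D.len d - i := by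
  have hedge : d.edge = d'.edge := by
    by_contra hne
    obtain ⟨w, hw⟩ := D.interior_disjoint d.adj d'.adj _ hne (D.pt_mem_support d i)
      (h ▸ D.pt_mem_support d' j)
    rcases D.eq_of_pt_eq_branch hi.le hw.symm with h | h <;> omega
  rcases (SimpleGraph.dart_edge_eq_iff d d').1 hedge with rfl | rfl
  · exact .inl ⟨rfl, (D.pt_inj hi.le hj h).symm⟩
  · refine .inr ⟨by simp, ?_⟩
    rw [pt_symm] at h
    rw [len_symm] at hi ⊢
    have := D.pt_inj (Nat.sub_le _ _) hj h
    omega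

theorem pt_adj {d : H.Dart} {i : ℕ} {z : W} (hi0 : 0 < i) (hi : i < D.len d)
    (h : K.Adj (D.pt d i) z) : z = D.pt d (i - 1) ∨ z = D.pt d (i + 1) := by
  obtain ⟨d', j, hj, h1, rfl⟩ := D.exists_pt_of_adj h
  rcases D.eq_or_symm_of_pt_eq hi0 hi hj.le h1.symm with ⟨rfl, rfl⟩ | ⟨rfl, rfl⟩
  · exact .inr rfl
  · left
    rw [pt_symm]
    congr 1
    omega

/-- A walk inside `M` that starts on the path replacing an edge stays on that path until it has
run through one of its ends. -/
theorem linked_pt {M : Set W} {d : H.Dart} {i : ℕ} {y : W} (hi : i ≤ D.len d)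
    (h : Linked K M (D.pt d i) y) :
    (∃ j ≤ D.len d, D.pt d j = y ∧ ∀ k, i ≤ k ∧ k ≤ j ∨ j ≤ k ∧ k ≤ i → D.pt d k ∈ M) ∨
      (∀ k ≤ i, D.pt d k ∈ M) ∨ ∀ k, i ≤ k → k ≤ D.len d → D.pt d k ∈ M := by
  have hM : D.pt d i ∈ M := by
    obtain ⟨p, hp⟩ := h
    exact hp _ (by simp)
  refine h.induct (fun y =>
    (∃ j ≤ D.len d, D.pt d j = y ∧ ∀ k, i ≤ k ∧ k ≤ j ∨ j ≤ k ∧ k ≤ i → D.pt d k ∈ M) ∨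
      (∀ k ≤ i, D.pt d k ∈ M) ∨ ∀ k, i ≤ k → k ≤ D.len d → D.pt d k ∈ M) ?_ ?_
  · exact .inl ⟨i, hi, rfl, fun k hk => by rwa [show k = i by omega]⟩
  rintro a b hab - hb (⟨j, hj, rfl, hM⟩ | h)
  swap
  · exact .inr h
  rcases Nat.eq_zero_or_pos j with rfl | hj0
  · exact .inr (.inl fun k hk => hM k (by omega))
  rcases hj.eq_or_lt with rfl | hjl
  · exact .inr (.inr fun k hk hk' => hM k (by omega))
  rcases D.pt_adj hj0 hjl hab with rfl | rfl
  · refine .inl ⟨j - 1, by omega, rfl, fun k hk => ?_⟩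
    rcases eq_or_ne k (j - 1) with rfl | hne
    exacts [hb, hM k (by omega)]
  · refine .inl ⟨j + 1, by omega, rfl, fun k hk => ?_⟩
    rcases eq_or_ne k (j + 1) with rfl | hne
    exacts [hb, hM k (by omega)]

/-! ### Few sets through a point cover as much as all of them -/

/-- Among the sets containing a run that starts at position `m`, choose one whose run reaches
furthest along `d`; if there is no such run, any element of `X` will do. -/
theorem exists_furthest {V : Type*} (Φ : V → Set W) {X : Set V} (hX : X.Nonempty) (d : H.Dart)
    (m : ℕ) : ∃ s ∈ X, ∀ v ∈ X, ∀ i, m ≤ i → i ≤ D.len d →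
      (∀ k, m ≤ k → k ≤ i → D.pt d k ∈ Φ v) → D.pt d i ∈ Φ s := by
  classical
  let P : ℕ → Prop := fun i => m ≤ i ∧ ∃ v ∈ X, ∀ k, m ≤ k → k ≤ i → D.pt d k ∈ Φ v
  by_cases hP : ∃ i ≤ D.len d, P i
  · obtain ⟨i, hi, hPi⟩ := hP
    obtain ⟨-, s, hs, hsk⟩ := Nat.findGreatest_spec hi hPi
    exact ⟨s, hs, fun v hv j hmj hj h =>
      hsk j hmj (Nat.le_findGreatest hj ⟨hmj, v, hv, h⟩)⟩
  · obtain ⟨s, hs⟩ := hX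
    exact ⟨s, hs, fun v hv j hmj hj h => absurd ⟨j, hj, hmj, v, hv, h⟩ hP⟩

/-- By `linked_pt`, a point `y` of a connected set through `x` is reached along its edge, inside the
set, from `x` or from an end of the edge. So for each dart it is enough to keep a furthest-reaching
set for each of these two starting positions: two choices for each of `2 * |E(H)|` darts. -/
theorem exists_cover [Fintype U] {V : Type*} (D : Subdivision H K) (hH : ∀ u, ∃ v, H.Adj u v) (Φ : V → Set W)
    (hΦ : ∀ v, IsLinked K (Φ v)) (x : W) :
    ∃ S : Finset V, S.card ≤ 4 * H.edgeSet.ncard ∧ (∀ s ∈ S, x ∈ Φ s) ∧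
      ∀ v, x ∈ Φ v → ∀ y ∈ Φ v, ∃ s ∈ S, y ∈ Φ s := by
  classical
  let X : Set V := {v | x ∈ Φ v}
  rcases X.eq_empty_or_nonempty with hX | hX
  · refine ⟨∅, by simp, by simp, fun v hv => ?_⟩
    have : v ∈ X := hv
    simp [hX] at this
  choose s hs hfar using D.exists_furthest Φ hX
  have hpos : ∀ d : H.Dart, ∃ m, ∀ j ≤ D.len d, D.pt d j = x → j = m := by
    intro d
    by_cases h : ∃ j ≤ D.len d, D.pt d j = x
    · obtain ⟨m, hm, rfl⟩ := h
      exact ⟨m, fun j hj h => D.pt_inj hj hm h⟩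
    · exact ⟨0, fun j hj hx => absurd ⟨j, hj, hx⟩ h⟩
  choose m hm using hpos
  let f : H.Dart × Bool → V := fun e => s e.1 (bif e.2 then m e.1 else 0)
  have hf0 : ∀ d, s d 0 ∈ Finset.univ.image f := fun d =>
    Finset.mem_image.2 ⟨(d, false), Finset.mem_univ _, rfl⟩
  have hfm : ∀ d, s d (m d) ∈ Finset.univ.image f := fun d =>
    Finset.mem_image.2 ⟨(d, true), Finset.mem_univ _, rfl⟩
  refine ⟨Finset.univ.image f, ?_, ?_, ?_⟩
  · refine Finset.card_image_le.trans ?_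
    rw [Finset.card_univ, Fintype.card_prod, H.dart_card_eq_twice_card_edges, Fintype.card_bool,
      Set.ncard_eq_toFinset_card', SimpleGraph.edgeFinset]
    omega
  · intro v hv
    obtain ⟨e, -, rfl⟩ := Finset.mem_image.1 hv
    exact hs _ _
  · intro v hv y hy
    obtain ⟨d, i, hi, rfl⟩ := D.exists_pt hH y
    rcases D.linked_pt hi (hΦ v _ hy x hv) with ⟨j, hj, hjx, hM⟩ | hM | hM
    · rcases le_total j i with hji | hij
      · obtain rfl := hm d j hj hjx
        exact ⟨_, hfm d, hfar d _ v hv i hji hi fun k hk hk' => hM k (by omega)⟩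
      -- Here `x` lies beyond `y`, so the run is read along the reversed dart.
      · have hjm := hm d.symm (D.len d - j) (by rw [len_symm]; omega)
          (by rw [pt_symm, show D.len d - (D.len d - j) = j by omega, hjx])
        refine ⟨_, hfm d.symm, ?_⟩
        have := hfar d.symm (m d.symm) v hv (D.len d - i) (by omega) (by rw [len_symm]; omega)
          fun k hk hk' => by rw [pt_symm]; exact hM _ (by omega)
        rwa [pt_symm, show D.len d - (D.len d - i) = i by omega] at this
    · exact ⟨_, hf0 d, hfar d 0 v hv i (Nat.zero_le _) hi fun k _ hk' => hM k hk'⟩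
    · refine ⟨_, hf0 d.symm, ?_⟩
      have := hfar d.symm 0 v hv (D.len d - i) (Nat.zero_le _) (by rw [len_symm]; omega)
        fun k _ hk' => by rw [pt_symm]; exact hM _ (by omega) (by omega)
      rwa [pt_symm, show D.len d - (D.len d - i) = i by omega] at this

/-! ### Hitting pairwise intersecting connected sets -/

/-- If one of the pairwise intersecting sets contains no vertex of `H`, two points suffice. -/
theorem exists_pair_hitting (hH : ∀ u, ∃ v, H.Adj u v) {κ : Type*} (M : κ → Set W)
    (hM : ∀ i, IsLinked K (M i)) (hinter : ∀ i j, (M i ∩ M j).Nonempty) (i₀ : κ)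
    (h₀ : ∀ u, D.branch u ∉ M i₀) :
    ∃ a b : W, ∀ i, a ∈ M i ∨ b ∈ M i := by
  classical
  obtain ⟨y₀, hy₀, -⟩ := hinter i₀ i₀
  obtain ⟨d, n₀, hn₀, rfl⟩ := D.exists_pt hH y₀
  -- Without branch vertices `M i₀` cannot leave the path of `d`; hence every `M i` meets that path.
  have hsub : ∀ y ∈ M i₀, ∃ j ≤ D.len d, D.pt d j = y := fun y hy => by
    rcases D.linked_pt hn₀ (hM i₀ _ hy₀ y hy) with ⟨j, hj, hjy, -⟩ | h | h
    · exact ⟨j, hj, hjy⟩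
    · exact absurd (D.pt_zero d ▸ h 0 (Nat.zero_le _)) (h₀ _)
    · exact absurd (D.pt_len d ▸ h _ hn₀ le_rfl) (h₀ _)
  let last : κ → ℕ → Prop := fun i r =>
    r ≤ D.len d ∧ D.pt d r ∈ M i ∧ ∀ k, r < k → k ≤ D.len d → D.pt d k ∉ M i
  have hlast : ∀ i, ∃ r, last i r := fun i => by
    obtain ⟨y, hy, hy'⟩ := hinter i i₀
    obtain ⟨j, hj, rfl⟩ := hsub y hy'
    refine ⟨Nat.findGreatest (fun k => D.pt d k ∈ M i) (D.len d), Nat.findGreatest_le _,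
      Nat.findGreatest_spec (P := fun k => D.pt d k ∈ M i) hj hy, fun k hk hk' =>
      Nat.findGreatest_is_greatest hk hk'⟩
  -- One point is the start of `d`. For the sets missing it, the other is the earliest of their last
  -- points on `d`, as when piercing intervals.
  let Q : ℕ → Prop := fun r => ∃ i, D.pt d 0 ∉ M i ∧ last i r
  have hex : ∃ r, Q r := by
    obtain ⟨r, hr⟩ := hlast i₀
    exact ⟨r, i₀, D.pt_zero d ▸ h₀ _, hr⟩
  obtain ⟨i, hi0, hrl, hri, hir⟩ := Nat.find_spec hex
  set r := Nat.find hex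
  refine ⟨D.pt d 0, D.pt d r, fun i' => or_iff_not_imp_left.2 fun hi'0 => ?_⟩
  obtain ⟨r', hr'⟩ := hlast i'
  have hrr' : r ≤ r' := Nat.find_min' hex ⟨i', hi'0, hr'⟩
  obtain ⟨hr'l, hr'i, -⟩ := hr'
  obtain ⟨z, hz, hz'⟩ := hinter i i'
  rcases D.linked_pt hrl (hM i _ hri z hz) with ⟨j, hj, rfl, -⟩ | h | h
  · have hjr : j ≤ r := not_lt.1 fun h => hir j h hj hz
    rcases D.linked_pt hr'l (hM i' _ hr'i _ hz') with ⟨j', hj', hjj', h⟩ | h | h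
    · obtain rfl := D.pt_inj hj' hj hjj'
      exact h r (.inr ⟨hjr, hrr'⟩)
    · exact h r hrr'
    -- `M i'` escapes from `r'` through the far end, so it is followed from the common point `z`
    -- instead.
    · clear h
      rcases D.linked_pt hj (hM i' _ hz' _ hr'i) with ⟨j', hj', hjj', h⟩ | h | h
      · obtain rfl := D.pt_inj hj' hr'l hjj'
        exact h r (.inl ⟨hjr, hrr'⟩)
      · exact absurd (h 0 (Nat.zero_le _)) hi'0
      · exact h r hjr hrl
  · exact absurd (h 0 (Nat.zero_le _)) hi0
  · have : ¬ r < D.len d := fun hlt => hir _ hlt le_rfl (h _ hrl le_rfl)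
    rwa [show r = r' by omega]

/-- `y` is reached from the vertex `w` of `H` by an initial part, inside `M`, of a path that
replaces an edge at `w`. -/
def Near (M : Set W) (w : U) (y : W) : Prop :=
  ∃ d : H.Dart, d.fst = w ∧ ∃ i ≤ D.len d, D.pt d i = y ∧ ∀ k ≤ i, D.pt d k ∈ M

variable {D}

theorem Near.mem {M : Set W} {w : U} {y : W} (h : D.Near M w y) : D.branch w ∈ M := by
  obtain ⟨d, rfl, i, -, -, hM⟩ := h
  exact D.pt_zero d ▸ hM 0 (Nat.zero_le _)

theorem near_branch (hH : ∀ u, ∃ v, H.Adj u v) {M : Set W} {w : U} (hw : D.branch w ∈ M) :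
    D.Near M w (D.branch w) := by
  obtain ⟨v, h⟩ := hH w
  refine ⟨⟨(w, v), h⟩, rfl, 0, Nat.zero_le _, D.pt_zero _, fun k hk => ?_⟩
  rw [Nat.le_zero.1 hk, D.pt_zero]
  exact hw

theorem Near.eq_or_adj {M : Set W} {w u : U} (h : D.Near M w (D.branch u)) :
    u = w ∨ H.Adj w u := by
  obtain ⟨d, rfl, i, hi, hy, -⟩ := h
  rcases D.eq_of_pt_eq_branch hi hy with h | h
  · exact .inl h.2
  · exact .inr (h.2 ▸ d.adj)

/-- The vertex of `H` from which the point is reached needs to change only when the walk leaves a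
branch vertex, and then it moves by at most one edge of `H`. -/
theorem Near.step {M : Set W} {w : U} {y z : W} (h : D.Near M w y) (hy : y ∈ M) (hz : z ∈ M)
    (hyz : K.Adj y z) : ∃ w', D.Near M w' z ∧ (w' = w ∨ H.Adj w w') := by
  have key : ∀ u, (u = w ∨ H.Adj w u) → D.branch u = y →
      ∃ w', D.Near M w' z ∧ (w' = w ∨ H.Adj w w') := by
    rintro u hu rfl
    obtain ⟨d, i, hi, h1, rfl⟩ := D.exists_pt_of_adj hyz
    rcases D.eq_of_pt_eq_branch hi.le h1 with ⟨rfl, rfl⟩ | ⟨h, -⟩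
    · refine ⟨d.fst, ⟨d, rfl, 1, by omega, rfl, fun k hk => ?_⟩, hu⟩
      rcases Nat.le_one_iff_eq_zero_or_eq_one.1 hk with rfl | rfl
      exacts [h1 ▸ hy, hz]
    · omega
  obtain ⟨d, rfl, i, hi, rfl, hM⟩ := h
  rcases Nat.eq_zero_or_pos i with rfl | hi0
  · exact key _ (.inl rfl) (D.pt_zero d).symm
  rcases hi.eq_or_lt with rfl | hil
  · exact key _ (.inr d.adj) (D.pt_len d).symm
  refine ⟨d.fst, ?_, .inl rfl⟩
  rcases D.pt_adj hi0 hil hyz with rfl | rfl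
  · exact ⟨d, rfl, i - 1, by omega, rfl, fun k hk => hM k (by omega)⟩
  · refine ⟨d, rfl, i + 1, by omega, rfl, fun k hk => ?_⟩
    rcases eq_or_ne k (i + 1) with rfl | hne
    exacts [hz, hM k (by omega)]

theorem exists_near (hH : ∀ u, ∃ v, H.Adj u v) {M : Set W} {u : U} {y : W}
    (hu : D.branch u ∈ M) (h : Linked K M (D.branch u) y) :
    ∃ w, D.Near M w y ∧ Linked H {w | D.branch w ∈ M} u w := by
  refine h.induct (fun y => ∃ w, D.Near M w y ∧ Linked H {w | D.branch w ∈ M} u w)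
    ⟨u, near_branch hH hu, .refl hu⟩ ?_
  rintro a b hab ha hb ⟨w, hw, huw⟩
  obtain ⟨w', hw', h⟩ := hw.step ha hb hab
  refine ⟨w', hw', ?_⟩
  rcases h with rfl | h
  exacts [huw, huw.trans (.of_adj h hw.mem hw'.mem)]

theorem isLinked_branch (hH : ∀ u, ∃ v, H.Adj u v) {M : Set W} (hM : IsLinked K M) :
    IsLinked H {w | D.branch w ∈ M} := by
  intro u hu v hv
  obtain ⟨w, hw, huw⟩ := exists_near hH hu (hM _ hu _ hv)
  rcases hw.eq_or_adj with rfl | h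
  exacts [huw, huw.trans (.of_adj h hw.mem hv)]

/-- If `y` is interior to a subdivided edge, then `w` and `w'` are both ends of that edge. If `y` is
a branch vertex in `M`, it is itself equal or adjacent to `w'`. -/
theorem Near.touch {M M' : Set W} {w w' : U} {y : W} (h : D.Near M w y) (h' : D.Near M' w' y) :
    ∃ u v, D.branch u ∈ M ∧ D.branch v ∈ M' ∧ (u = v ∨ H.Adj u v) := by
  have hw := h.mem
  have hw' := h'.mem
  obtain ⟨d, rfl, i, hi, rfl, hM⟩ := h
  rcases Nat.eq_zero_or_pos i with rfl | hi0
  · rw [D.pt_zero] at h'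
    exact ⟨_, _, hw, hw', h'.eq_or_adj.imp id SimpleGraph.Adj.symm⟩
  rcases hi.eq_or_lt with rfl | hil
  · have hs : D.branch d.snd ∈ M := D.pt_len d ▸ hM _ le_rfl
    rw [D.pt_len] at h'
    exact ⟨_, _, hs, hw', h'.eq_or_adj.imp id SimpleGraph.Adj.symm⟩
  obtain ⟨d', rfl, j, hj, hij, -⟩ := h'
  refine ⟨_, _, hw, hw', ?_⟩
  rcases D.eq_or_symm_of_pt_eq hi0 hil hj hij.symm with ⟨rfl, -⟩ | ⟨rfl, -⟩
  exacts [.inl rfl, .inr d.adj]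

theorem exists_touch (hH : ∀ u, ∃ v, H.Adj u v) {M M' : Set W} (hM : IsLinked K M)
    (hM' : IsLinked K M') (hMM' : (M ∩ M').Nonempty) {u u' : U} (hu : D.branch u ∈ M)
    (hu' : D.branch u' ∈ M') :
    ∃ v v', D.branch v ∈ M ∧ D.branch v' ∈ M' ∧ (v = v' ∨ H.Adj v v') := by
  obtain ⟨z, hz, hz'⟩ := hMM'
  obtain ⟨w, hw, -⟩ := exists_near hH hu (hM _ hu _ hz)
  obtain ⟨w', hw', -⟩ := exists_near hH hu' (hM' _ hu' _ hz')
  exact hw.touch hw'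

end Subdivision

/-! ### Tree decompositions -/

/-- Some bag of a tree decomposition meets all sets of a bramble. -/
theorem TreeDecomposition.exists_bag_hitting {U ι κ : Type*} {H : SimpleGraph U}
    (D : TreeDecomposition H ι) [Finite κ] [Nonempty κ] (N : κ → Set U)
    (hne : ∀ i, (N i).Nonempty) (hN : ∀ i, IsLinked H (N i))
    (htouch : ∀ i j, ∃ u ∈ N i, ∃ v ∈ N j, u = v ∨ H.Adj u v) :
    ∃ t, ∀ i, ∃ u ∈ N i, u ∈ D.bag t := by
  -- The nodes whose bags meet `N i` form a subtree, since adjacent vertices of `N i` share a bag;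
  -- touching sets give intersecting subtrees.
  refine exists_mem_of_pairwise_inter D.isTree (fun i => {t | ∃ u ∈ N i, u ∈ D.bag t}) ?_ ?_ ?_
  · intro i
    obtain ⟨u, hu⟩ := hne i
    obtain ⟨t, ht⟩ := D.mem_bag u
    exact ⟨t, u, hu, ht⟩
  · rintro i t ⟨u, hu, hut⟩ t' ⟨u', hu', hut'⟩
    have hlink : ∀ v ∈ N i, ∀ s s', v ∈ D.bag s → v ∈ D.bag s' →
        Linked D.tree {t | ∃ u ∈ N i, u ∈ D.bag t} s s' := fun v hv s s' hs hs' =>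
      (Linked.of_connected (D.connected_bag v) hs hs').mono fun r hr => ⟨v, hv, hr⟩
    refine (hN i u hu u' hu').induct (fun v => ∀ s, v ∈ D.bag s →
      Linked D.tree {t | ∃ u ∈ N i, u ∈ D.bag t} t s) (fun s hs => hlink u hu t s hut hs) ?_ t' hut'
    intro a b hab ha hb h s hs
    obtain ⟨r, hra, hrb⟩ := D.adj_bag a b hab
    exact (h r hra).trans (hlink b hb r s hrb hs)
  · intro i j
    obtain ⟨u, hu, v, hv, h⟩ := htouch i j
    obtain ⟨t, htu, htv⟩ : ∃ t, u ∈ D.bag t ∧ v ∈ D.bag t := by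
      rcases h with rfl | h
      · obtain ⟨t, ht⟩ := D.mem_bag u
        exact ⟨t, ht, ht⟩
      · exact D.adj_bag u v h
    exact ⟨t, ⟨u, hu, htu⟩, ⟨v, hv, htv⟩⟩

theorem exists_width_eq_treewidth {U : Type*} [Fintype U] (H : SimpleGraph U) :
    ∃ (ι : Type) (_ : Fintype ι) (D : TreeDecomposition H ι), D.width = treewidth H := by
  refine Nat.sInf_mem (s := {k | ∃ (ι : Type) (_ : Fintype ι) (D : TreeDecomposition H ι),
    D.width = k}) ⟨_, Unit, inferInstance, ?_, rfl⟩
  exact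
    { tree := ⊥
      isTree := .of_subsingleton
      bag := fun _ => Finset.univ
      mem_bag := fun v => ⟨(), Finset.mem_univ v⟩
      adj_bag := fun u v _ => ⟨(), Finset.mem_univ u, Finset.mem_univ v⟩
      connected_bag := fun v =>
        { preconnected := fun a b => by rw [Subsingleton.elim a b]
          nonempty := ⟨⟨(), Finset.mem_univ v⟩⟩ } }

theorem TreeDecomposition.card_bag_le {U ι : Type*} {H : SimpleGraph U} [Fintype ι]
    (D : TreeDecomposition H ι) (t : ι) : (D.bag t).card ≤ D.width + 1 := by
  have := Finset.le_sup (f := fun t => (D.bag t).card) (Finset.mem_univ t)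
  simp only [width] at *
  omega

/-- This makes room for the two points of `exists_pair_hitting` within the bound `treewidth H + 1`.
-/
theorem one_le_treewidth {U : Type*} [Fintype U] {H : SimpleGraph U} {u v : U} (h : H.Adj u v) :
    1 ≤ treewidth H := by
  obtain ⟨ι, _, D, hD⟩ := exists_width_eq_treewidth H
  obtain ⟨t, hu, hv⟩ := D.adj_bag u v h
  have h1 := D.card_bag_le t
  have h2 : 1 < (D.bag t).card := Finset.one_lt_card.2 ⟨u, hu, v, hv, h.ne⟩
  omega

/-- Pairwise intersecting connected sets of vertices of a subdivision of `H` are hit by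
`treewidth H + 1` vertices. -/
theorem Subdivision.exists_hitting {U W κ : Type*} [Fintype U] {H : SimpleGraph U}
    {K : SimpleGraph W} (D : Subdivision H K) (hH : ∀ u, ∃ v, H.Adj u v) [Finite κ] [Nonempty κ]
    (M : κ → Set W) (hM : ∀ i, IsLinked K (M i)) (hinter : ∀ i j, (M i ∩ M j).Nonempty) :
    ∃ B : Finset W, B.card ≤ treewidth H + 1 ∧ ∀ i, ∃ x ∈ B, x ∈ M i := by
  classical
  by_cases h : ∀ i, ∃ u, D.branch u ∈ M i
  · obtain ⟨ι, _, T, hT⟩ := exists_width_eq_treewidth H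
    obtain ⟨t, ht⟩ := T.exists_bag_hitting (fun i => {u | D.branch u ∈ M i}) h
      (fun i => isLinked_branch hH (hM i)) fun i j => by
        obtain ⟨u, hu⟩ := h i
        obtain ⟨u', hu'⟩ := h j
        obtain ⟨v, v', hv, hv', hvv'⟩ := exists_touch hH (hM i) (hM j) (hinter i j) hu hu'
        exact ⟨v, hv, v', hv', hvv'⟩
    refine ⟨(T.bag t).map D.branch, ?_, fun i => ?_⟩
    · rw [Finset.card_map, ← hT]
      exact T.card_bag_le t
    · obtain ⟨u, hu, hut⟩ := ht i
      exact ⟨_, Finset.mem_map_of_mem _ hut, hu⟩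
  · push Not at h
    obtain ⟨i₀, h₀⟩ := h
    obtain ⟨a, b, hab⟩ := D.exists_pair_hitting hH M hM hinter i₀ h₀
    refine ⟨{a, b}, ?_, fun i => ?_⟩
    · obtain ⟨y, -⟩ := hinter i₀ i₀
      obtain ⟨d, -⟩ := D.exists_pt hH y
      have := one_le_treewidth d.adj
      exact Finset.card_le_two.trans (by omega)
    · rcases hab i with h | h
      exacts [⟨a, by simp, h⟩, ⟨b, by simp, h⟩]

/-! ### Transversals of `H`-graphs -/

namespace Representation

variable {U V W : Type*} {H : SimpleGraph U} {G : SimpleGraph V} {K : SimpleGraph W}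
  (R : Representation H G K)

theorem isLinked_segment (v : V) : IsLinked K (R.segment v) := fun _ hx _ hy =>
  .of_connected (R.connected_segment v) hx hy

/-- Segments of consecutive vertices of the walk intersect, so their union stays connected. -/
theorem isLinked_iUnion_support {u v : V} (p : G.Walk u v) :
    IsLinked K {x | ∃ w ∈ p.support, x ∈ R.segment w} := by
  suffices h : ∀ a ∈ R.segment u, ∀ y, (∃ w ∈ p.support, y ∈ R.segment w) →
      Linked K {x | ∃ w ∈ p.support, x ∈ R.segment w} a y by
    obtain ⟨⟨a, ha⟩⟩ := (R.connected_segment u).nonempty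
    exact fun x hx y hy => (h a ha x hx).symm.trans (h a ha y hy)
  induction p with
  | nil =>
    rintro a ha y ⟨w, hw, hy⟩
    obtain rfl : w = _ := by simpa using hw
    exact (R.isLinked_segment w a ha y hy).mono fun x hx => ⟨w, by simp, hx⟩
  | @cons u w _ huw q ih =>
    obtain ⟨b, hbu, hbw⟩ := (R.adj_iff u w huw.ne).1 huw
    have hu : ∀ a ∈ R.segment u, ∀ y ∈ R.segment u,
        Linked K {x | ∃ w' ∈ (SimpleGraph.Walk.cons huw q).support, x ∈ R.segment w'} a y :=
      fun a ha y hy => (R.isLinked_segment u a ha y hy).mono fun x hx => ⟨u, by simp, hx⟩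
    rintro a ha y ⟨w', hw', hy⟩
    rcases List.mem_cons.1 (SimpleGraph.Walk.support_cons huw q ▸ hw') with rfl | hw'
    · exact hu a ha y hy
    · exact (hu a ha b hbu).trans ((ih b hbw y ⟨w', hw', hy⟩).mono
        (by rintro x ⟨z, hz, hx⟩; exact ⟨z, by simp [hz], hx⟩))

/-- If the segments of the vertices of `S` contain `x` and cover all segments containing `x`, then
`S` meets each longest path with a vertex whose segment contains `x`. -/
theorem exists_mem_support_of_cover {x : W} {S : Finset V} (hS : ∀ s ∈ S, x ∈ R.segment s)
    (hcover : ∀ v, x ∈ R.segment v → ∀ y ∈ R.segment v, ∃ s ∈ S, y ∈ R.segment s)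
    {a b v : V} {p : G.Walk a b} (hp : IsLongestPath p) (hv : v ∈ p.support)
    (hxv : x ∈ R.segment v) : ∃ s ∈ S, s ∈ p.support := by
  obtain ⟨s₀, hs₀, -⟩ := hcover v hxv x hxv
  refine hp.exists_mem_support hv ⟨s₀, hs₀⟩ (fun s hs hvs => ?_) fun w hvw => ?_
  · exact (R.adj_iff v s hvs).2 ⟨x, hxv, hS s hs⟩
  · obtain ⟨y, hyv, hyw⟩ := (R.adj_iff v w hvw.ne).1 hvw
    obtain ⟨s, hs, hys⟩ := hcover v hxv y hyv
    exact ⟨s, hs, fun hsw => (R.adj_iff s w hsw).2 ⟨y, hys, hyw⟩⟩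

end Representation

end HGraphs

open HGraphs in
theorem mainTheorem5 {U V : Type*} [Fintype U] [Fintype V]
    (H : SimpleGraph U) (hH : H.Connected) (hcard : 2 ≤ Fintype.card U)
    (G : SimpleGraph V) (hG : G.Connected) (hGH : HGraphs.IsHGraph H G) :
    HGraphs.lpt G ≤ 4 * (HGraphs.treewidth H + 1) * H.edgeSet.ncard := by
  classical
  obtain ⟨W, _, K, ⟨R⟩⟩ := hGH
  have hadj : ∀ u, ∃ v, H.Adj u v := fun u => by
    have : Nontrivial U := Fintype.one_lt_card_iff_nontrivial.1 hcard
    exact hH.preconnected.exists_adj_of_nontrivial u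
  suffices h : ∃ S : Finset V, IsLongestPathTransversal G S ∧
      S.card ≤ 4 * (treewidth H + 1) * H.edgeSet.ncard by
    obtain ⟨S, hS, hcard⟩ := h
    exact (Nat.sInf_le
      (s := {k | ∃ S : Finset V, IsLongestPathTransversal G S ∧ S.card = k}) ⟨S, hS, rfl⟩).trans hcard
  -- Indexing by the sets themselves rather than by paths makes the family finite because `W` is.
  let N : Set (Set W) := {M | ∃ (u v : V) (p : G.Walk u v), IsLongestPath p ∧
    M = {x | ∃ w ∈ p.support, x ∈ R.segment w}}
  rcases isEmpty_or_nonempty N with hN | hN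
  · exact ⟨∅, fun u v p hp => hN.elim ⟨_, u, v, p, hp, rfl⟩, by simp⟩
  obtain ⟨B, hBcard, hB⟩ := R.subdivision.exists_hitting hadj (fun M : N => M.1)
    (by rintro ⟨_, u, v, p, -, rfl⟩; exact R.isLinked_iUnion_support p)
    (by
      rintro ⟨_, u, v, p, hp, rfl⟩ ⟨_, u', v', q, hq, rfl⟩
      obtain ⟨w, hwp, hwq⟩ := IsLongestPath.exists_common hG hp hq
      obtain ⟨⟨x, hx⟩⟩ := (R.connected_segment w).nonempty
      exact ⟨x, ⟨w, hwp, hx⟩, ⟨w, hwq, hx⟩⟩)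
  choose S hScard hSx hScover using R.subdivision.exists_cover hadj R.segment R.isLinked_segment
  refine ⟨B.biUnion S, fun u v p hp => ?_, ?_⟩
  · obtain ⟨x, hxB, w, hw, hxw⟩ := hB ⟨{x | ∃ w ∈ p.support, x ∈ R.segment w}, u, v, p, hp, rfl⟩
    obtain ⟨s, hs, hsp⟩ := R.exists_mem_support_of_cover (hSx x) (hScover x) hp hw hxw
    exact ⟨s, Finset.mem_biUnion.2 ⟨x, hxB, hs⟩, hsp⟩
  · calc (B.biUnion S).card ≤ B.card * (4 * H.edgeSet.ncard) :=
          Finset.card_biUnion_le_card_mul _ _ _ fun x _ => hScard x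
      _ ≤ (treewidth H + 1) * (4 * H.edgeSet.ncard) := Nat.mul_le_mul_right _ hBcard
      _ = 4 * (treewidth H + 1) * H.edgeSet.ncard := by ring
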